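/- Permutations are finite, in one-line notation, of any length $n\ge 0$. A permutation $\pi$ involves $\sigma$ if $\pi$ has a subsequence with the same relative order as $\sigma$; for a set $B$ of permutations, $\mathrm{Av}(B)$ is the set of all permutations that involve no element of $B$. Write $\alpha\oplus\beta$ for the direct sum (the sequence $\alpha$ followed by the sequence $\beta$ with all its values increased by $|\alpha|$), and $1$ for the permutation of length one. A permutation $\alpha\in\mathrm{Av}(321)$ is 2-rigid if each of its elements belongs to a decreasing subsequence of length $2$. The growth rate of a set $\mathcal C$ of permutations is $s(\mathcal C)=\limsup_{n\to\infty}|\mathcal C\cap S_n|^{1/n}\in[0,\infty]$. **Proposition 3.6.** Let $X\subseteq\mathrm{Av}(321)$ be any set (finite or infinite), let $\alpha,\beta\in\mathrm{Av}(321)$ with $\alpha$ 2-rigid, and suppose that $\alpha\oplus\beta\in\mathrm{Av}(321)\cap\mathrm{Av}(X)$ and that $\mathcal C=\mathrm{Av}(321)\cap\mathrm{Av}(X)\cap\mathrm{Av}(\alpha\oplus\beta)$ is infinite. Put $\mathcal C'=\mathrm{Av}(321)\cap\mathrm{Av}(X)\cap\mathrm{Av}(\alpha\oplus 1\oplus\beta)$.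 Then $s(\mathcal C)=s(\mathcal C')$. -/

import Mathlib

namespace PermPattern

/-- A finite permutation (in one-line notation `π 0, π 1, …, π (n-1)`), of any length `n ≥ 0`. -/
abbrev FinPerm : Type := Σ n : ℕ, Equiv.Perm (Fin n)

/-- An embedding of `σ` in `π`: a map of positions respecting the order by position and
the order by value. -/
structure Embedding (σ π : FinPerm) where
  toFun : Fin σ.1 → Fin π.1
  position_lt_iff : ∀ i j, toFun i < toFun j ↔ i < j
  value_lt_iff : ∀ i j, π.2 (toFun i) < π.2 (toFun j) ↔ σ.2 i < σ.2 j

/-- `π` involves (contains) the pattern `σ`. -/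
def Involves (π σ : FinPerm) : Prop := Nonempty (Embedding σ π)

/-- The class of all permutations that involve no element of `B`. -/
def Av (B : Set FinPerm) : Set FinPerm := {π | ∀ σ ∈ B, ¬ Involves π σ}

/-- The decreasing permutation of length `k`; `decreasing 3` is `321`. -/
def decreasing (k : ℕ) : FinPerm := ⟨k, Fin.revPerm⟩

/-- The permutation of length one. -/
def single : FinPerm := ⟨1, 1⟩

/-- The direct sum: `α` occupies the first `|α|` positions and the smallest `|α|` values,
followed by a copy of `β` shifted up by `|α|`. -/
def directSum (α β : FinPerm) : FinPerm :=
  ⟨α.1 + β.1, finSumFinEquiv.permCongr (Equiv.Perm.sumCongr α.2 β.2)⟩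

/-- `π` is `k`-rigid: it avoids the decreasing permutation of length `k + 1`, and each of its
elements belongs to a decreasing subsequence of length `k`. -/
def IsRigid (k : ℕ) (π : FinPerm) : Prop :=
  π ∈ Av {decreasing (k + 1)} ∧
    ∀ x : Fin π.1, ∃ f : Embedding (decreasing k) π, ∃ i, f.toFun i = x

/-- The number of elements of `C` of length `n`. -/
noncomputable def count (C : Set FinPerm) (n : ℕ) : ℕ :=
  Set.ncard {π : Equiv.Perm (Fin n) | (⟨n, π⟩ : FinPerm) ∈ C}

/-- The growth rate `limsup |C ∩ Sₙ| ^ (1 / n)`, taken in `[0, ∞]`. -/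
noncomputable def growthRate (C : Set FinPerm) : ENNReal :=
  Filter.limsup (fun n : ℕ => (count C n : ENNReal) ^ (1 / (n : ℝ))) Filter.atTop

end PermPattern

open PermPattern

/-! Avoiding `α ⊕ β` implies avoiding `α ⊕ 1 ⊕ β`, so only `s(𝒞') ≤ s(𝒞)` needs work. It suffices to
encode each `π ∈ 𝒞'` of length `n` by two members of `𝒞` of total length at most `n` and boundedly
many numbers at most `n`. An infinite class has growth rate at least 1, so convolving its counting
sequence with itself and multiplying by a polynomial does not raise the growth rate
(`growthRate_le_of_isCode`).

Finding the two parts. Suppose that `π ∈ 𝒞'` involves `α ⊕ β`, with `β` nonempty. As `α` is 2-rigid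
and `π` avoids 321, the pointwise minimum of two copies of `α` in `π` is again a copy, so there is a
least copy (`exists_least_embedding`). Let `Q` be the set of elements above and to the right of all
of it. In any copy of `α ⊕ β` the `β` lies in `Q`, and the `α` can be exchanged for the least copy;
hence no element of `Q` is below and to the left of that `β`. Let `p` be the leftmost and `q` the
lowest element of `Q`. If `p = q`, deleting it leaves a member of `𝒞`. Otherwise they form an
inversion, and the elements outside its range of positions, like those outside its range of values,
form a member of `𝒞` (`hasCut_of_involves`).

Reassembling. The remaining elements are coloured so that blue ones avoid the range of positions and
the others, called red, avoid the range of values. The colouring must be recoverable from the two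
patterns. Starting from the positions up to `q` and the values up to `π p`, two initial segments are
extended in turn, each to the furthest point selected by the other. Avoidance of 321 makes the
position and the value of an element enter at consecutive steps, so colouring by parity is
consistent (`bluePos_iff_blueVal`). At each step all new positions have one colour and all new
values the other, so the extension can be computed from the patterns of the two parts
(`Coloured.chain_eq`). A dual chain treats the elements below and to the left. Twelve numbers give
the inversion and the starting data (`CutAt.eq_of_cutKey_eq`). -/

namespace PermPattern

/-! ### Alternating chains of initial segments in a 321-avoider -/

section Chain

variable {A B : Type*} [LinearOrder A]

/-- The positions weakly to the left of some element whose value lies in `v`. -/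
def reach (π : A ≃ B) (v : Set B) : Set A := {i | ∃ j, π j ∈ v ∧ i ≤ j}

theorem isLowerSet_reach (π : A ≃ B) (v : Set B) : IsLowerSet (reach π v) := by
  rintro a b hba ⟨j, hj, haj⟩
  exact ⟨j, hj, hba.trans haj⟩

theorem reach_mono (π : A ≃ B) {v w : Set B} (h : v ⊆ w) : reach π v ⊆ reach π w := by
  rintro i ⟨j, hj, hij⟩
  exact ⟨j, h hj, hij⟩

variable [LinearOrder B]

/-- Starting from a set of positions and a set of values, repeatedly replace each of them by the
lower closure of what the other one selects. -/
def chain (π : A ≃ B) (s : Set A × Set B) : ℕ → Set A × Set B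
  | 0 => s
  | k + 1 => (reach π (chain π s k).2, reach π.symm (chain π s k).1)

theorem chain_swap (π : A ≃ B) (s : Set A × Set B) (k : ℕ) :
    chain π.symm s.swap k = (chain π s k).swap := by
  induction k with
  | zero => rfl
  | succ k ih => simp [chain, ih]

/-- Starting data for which the chain consists of lower sets and increases. -/
structure ChainStart (π : A ≃ B) (s : Set A × Set B) : Prop where
  lower_fst : IsLowerSet s.1
  lower_snd : IsLowerSet s.2
  fst_subset : s.1 ⊆ reach π s.2
  snd_subset : s.2 ⊆ reach π.symm s.1

variable {π : A ≃ B} {s : Set A × Set B}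

theorem ChainStart.symm (h : ChainStart π s) : ChainStart π.symm s.swap :=
  ⟨h.lower_snd, h.lower_fst, h.snd_subset, h.fst_subset⟩

theorem ChainStart.succ_subset (h : ChainStart π s) (k : ℕ) :
    (chain π s k).1 ⊆ (chain π s (k + 1)).1 ∧ (chain π s k).2 ⊆ (chain π s (k + 1)).2 := by
  induction k with
  | zero => exact ⟨h.fst_subset, h.snd_subset⟩
  | succ k ih => exact ⟨reach_mono π ih.2, reach_mono π.symm ih.1⟩

theorem ChainStart.fst_mono (h : ChainStart π s) : Monotone fun k => (chain π s k).1 :=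
  monotone_nat_of_le_succ fun k => (h.succ_subset k).1

theorem ChainStart.snd_mono (h : ChainStart π s) : Monotone fun k => (chain π s k).2 :=
  monotone_nat_of_le_succ fun k => (h.succ_subset k).2

theorem ChainStart.lower (h : ChainStart π s) (k : ℕ) :
    IsLowerSet (chain π s k).1 ∧ IsLowerSet (chain π s k).2 := by
  cases k with
  | zero => exact ⟨h.lower_fst, h.lower_snd⟩
  | succ k => exact ⟨isLowerSet_reach _ _, isLowerSet_reach _ _⟩

/-- Position `i` enters the chain at step `k + 1`. -/
def EntersPos (π : A ≃ B) (s : Set A × Set B) (k : ℕ) (i : A) : Prop :=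
  i ∈ (chain π s (k + 1)).1 ∧ i ∉ (chain π s k).1

/-- Value `b` enters the chain at step `k + 1`. -/
def EntersVal (π : A ≃ B) (s : Set A × Set B) (k : ℕ) (b : B) : Prop :=
  b ∈ (chain π s (k + 1)).2 ∧ b ∉ (chain π s k).2

theorem entersPos_symm (k : ℕ) (b : B) : EntersPos π.symm s.swap k b ↔ EntersVal π s k b := by
  simp [EntersPos, EntersVal, chain_swap]

theorem entersVal_symm (k : ℕ) (i : A) : EntersVal π.symm s.swap k i ↔ EntersPos π s k i := by
  simp [EntersPos, EntersVal, chain_swap]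

theorem EntersPos.unique (h : ChainStart π s) {k l : ℕ} {i : A} (hk : EntersPos π s k i)
    (hl : EntersPos π s l i) : k = l := by
  rcases lt_trichotomy k l with hkl | hkl | hkl
  · exact absurd (h.fst_mono hkl hk.1) hl.2
  · exact hkl
  · exact absurd (h.fst_mono hkl hl.1) hk.2

theorem EntersVal.unique (h : ChainStart π s) {k l : ℕ} {b : B} (hk : EntersVal π s k b)
    (hl : EntersVal π s l b) : k = l :=
  EntersPos.unique h.symm ((entersPos_symm k b).2 hk) ((entersPos_symm l b).2 hl)

theorem EntersPos.notMem_start (h : ChainStart π s) {k : ℕ} {i : A} (hk : EntersPos π s k i) :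
    i ∉ s.1 := fun hi => hk.2 (h.fst_mono (Nat.zero_le k) hi)

theorem EntersVal.notMem_start (h : ChainStart π s) {k : ℕ} {b : B} (hk : EntersVal π s k b) :
    b ∉ s.2 := fun hi => hk.2 (h.snd_mono (Nat.zero_le k) hi)

/-- A `321` pattern is absent. -/
def No321 (π : A ≃ B) : Prop := ∀ i j k, i < j → j < k → π j < π i → π k < π j → False

theorem No321.symm (h : No321 π) : No321 π.symm := by
  intro i j k hij hjk h1 h2
  exact h _ _ _ h2 h1 (by simpa using hjk) (by simpa using hij)

/-- The element that brings in position `i` lies to its right and below, the one that brings in its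
value lies to its left and above; with `i` in the middle they form a 321. -/
theorem not_enters_both (h : ChainStart π s) (hπ : No321 π) {k : ℕ} {i : A}
    (hi : EntersPos π s k i) (hv : EntersVal π s k (π i)) : False := by
  obtain ⟨⟨j, hj, hij⟩, hik⟩ := hi
  obtain ⟨⟨b, hb, hib⟩, hvk⟩ := hv
  have hlow := h.lower k
  have hij' : i < j := lt_of_le_of_ne hij (by rintro rfl; exact hvk hj)
  have hji : π j < π i := lt_of_not_ge fun hle => hvk (hlow.2 hle hj)
  have hbi : π.symm b < i := lt_of_not_ge fun hle => hik (hlow.1 hle hb)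
  have hib' : π i < b := lt_of_le_of_ne hib (by rintro rfl; simp at hbi)
  exact hπ (π.symm b) i j hbi hij' (by simpa using hib') hji

/-- A position present at one stage forces its value at the next, and conversely. So the value
enters at most one step before or after the position, and `not_enters_both` excludes the same step.
This shift by one is why `BluePos` and `BlueVal` use opposite parities. -/
theorem EntersPos.exists_entersVal (h : ChainStart π s) (hπ : No321 π) {k : ℕ} {i : A}
    (hi : EntersPos π s k i) (hv : π i ∉ s.2) :
    ∃ l, (Odd l ↔ Even k) ∧ EntersVal π s l (π i) := by
  have h2 : π i ∈ (chain π s (k + 2)).2 := ⟨π i, by simpa using hi.1, le_rfl⟩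
  by_cases h1 : π i ∈ (chain π s (k + 1)).2
  · have h0 : π i ∈ (chain π s k).2 := by
      by_contra h0
      exact not_enters_both h hπ hi ⟨h1, h0⟩
    obtain _ | k := k
    · exact absurd h0 hv
    · refine ⟨k, by simp [parity_simps], h0, fun hk => hi.2 ⟨i, hk, le_rfl⟩⟩
  · exact ⟨k + 1, by simp [parity_simps], h2, h1⟩

theorem EntersVal.exists_entersPos (h : ChainStart π s) (hπ : No321 π) {k : ℕ} {i : A}
    (hv : EntersVal π s k (π i)) (hi : i ∉ s.1) :
    ∃ l, (Odd l ↔ Even k) ∧ EntersPos π s l i := by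
  obtain ⟨l, hl, hl'⟩ := EntersPos.exists_entersVal h.symm hπ.symm
    ((entersPos_symm k (π i)).2 hv) (by simpa using hi)
  exact ⟨l, hl, by simpa [entersVal_symm] using hl'⟩

/-- Positions entering the chain at an odd step. -/
def BluePos (π : A ≃ B) (s : Set A × Set B) (i : A) : Prop := ∃ k, Even k ∧ EntersPos π s k i

/-- Values entering the chain at a positive even step. -/
def BlueVal (π : A ≃ B) (s : Set A × Set B) (b : B) : Prop := ∃ k, Odd k ∧ EntersVal π s k b

theorem bluePos_iff_blueVal (h : ChainStart π s) (hπ : No321 π) {i : A}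
    (hi : i ∉ s.1) (hv : π i ∉ s.2) : BluePos π s i ↔ BlueVal π s (π i) := by
  constructor
  · rintro ⟨k, hk, hki⟩
    obtain ⟨l, hl, hl'⟩ := hki.exists_entersVal h hπ hv
    exact ⟨l, hl.2 hk, hl'⟩
  · rintro ⟨k, hk, hki⟩
    obtain ⟨l, hl, hl'⟩ := hki.exists_entersPos h hπ hi
    refine ⟨l, ?_, hl'⟩
    rw [← Nat.not_odd_iff_even, hl, Nat.not_even_iff_odd]
    exact hk

end Chain

/-! ### The chain is determined by the patterns of the two colours -/

section Determinacy

/-- The two preimages are initial segments of the same order on `ι`, hence nested, and equal size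
makes them equal. This is how a single number in the key encodes a set. -/
theorem mem_iff_mem_of_ncard_eq {ι A A' : Type*} [Finite ι] [LinearOrder A] [LinearOrder A']
    {x : ι → A} {x' : ι → A'} (hx : ∀ i j, x i < x j ↔ x' i < x' j) {D : Set A} {D' : Set A'}
    (hD : IsLowerSet D) (hD' : IsLowerSet D')
    (hcard : {i | x i ∈ D}.ncard = {i | x' i ∈ D'}.ncard) (i : ι) : x i ∈ D ↔ x' i ∈ D' := by
  constructor
  · intro hi
    by_contra hi'
    have hsub : {i | x' i ∈ D'} ⊂ {i | x i ∈ D} := by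
      refine ⟨fun j hj => ?_, fun hle => hi' (hle hi)⟩
      have : x' j < x' i := lt_of_not_ge fun hle => hi' (hD' hle hj)
      exact hD ((hx j i).2 this).le hi
    exact absurd hcard (Set.ncard_lt_ncard hsub).ne'
  · intro hi
    by_contra hi'
    have hsub : {i | x i ∈ D} ⊂ {i | x' i ∈ D'} := by
      refine ⟨fun j hj => ?_, fun hle => hi' (hle hi)⟩
      have : x j < x i := lt_of_not_ge fun hle => hi' (hD hle hj)
      exact hD' ((hx j i).1 this).le hi
    exact absurd hcard (Set.ncard_lt_ncard hsub).ne

theorem mem_range_of_symm {A B ν : Type*} [LinearOrder B] {π : A ≃ B} {x : ν → A} {t : Set A}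
    {v : Set B} (hx : ∀ i, π i ∈ reach π.symm t ∧ π i ∉ v → i ∈ Set.range x) :
    ∀ b ∈ reach π.symm t, b ∉ v → b ∈ Set.range fun i => π (x i) := by
  intro b hb hbv
  obtain ⟨i, hi⟩ := hx (π.symm b) (by simpa using ⟨hb, hbv⟩)
  exact ⟨i, by simp [hi]⟩

variable {A B ι κ : Type*} [LinearOrder A] [Finite A]

/-- Everything new in `reach π v` has the colour of `e`, so the pattern of `e` decides which of its
elements are new and hence how many positions are. An initial segment is determined by its size.
Elements of the colour of `g` gain nothing at this step. -/
theorem reach_eq_reach {π π' : A ≃ B} {e e' : ι → A} {g g' : κ → A} {t : Set A} {v : Set B}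
    (he : Function.Injective e) (he' : Function.Injective e')
    (hlt : ∀ i j, e i < e j ↔ e' i < e' j)
    (hdisj : ∀ i j, e i ≠ g j) (hdisj' : ∀ i j, e' i ≠ g' j)
    (ht : ∀ i, e i ∈ t ↔ e' i ∈ t) (hv : ∀ i, π (e i) ∈ v ↔ π' (e' i) ∈ v)
    (hgt : ∀ i, g i ∈ t ↔ g' i ∈ t) (htl : IsLowerSet t)
    (hsub : t ⊆ reach π v) (hsub' : t ⊆ reach π' v)
    (hcov : ∀ i ∈ reach π v, i ∉ t → i ∈ Set.range e)
    (hcov' : ∀ i ∈ reach π' v, i ∉ t → i ∈ Set.range e') :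
    reach π v = reach π' v ∧ (∀ i, e i ∈ reach π v ↔ e' i ∈ reach π' v) ∧
      ∀ i, g i ∈ reach π v ↔ g' i ∈ reach π' v := by
  have key : ∀ i, e i ∈ reach π v ↔ e' i ∈ reach π' v := by
    intro i
    by_cases hi : e i ∈ t
    · exact iff_of_true (hsub hi) (hsub' ((ht i).1 hi))
    have hi' : e' i ∉ t := fun h => hi ((ht i).2 h)
    constructor
    · rintro ⟨j, hj, hij⟩
      obtain ⟨j, rfl⟩ := hcov j ⟨j, hj, le_rfl⟩ fun h => hi (htl hij h)
      exact ⟨e' j, (hv j).1 hj, le_of_not_gt fun h => hij.not_gt ((hlt _ _).2 h)⟩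
    · rintro ⟨j, hj, hij⟩
      obtain ⟨j, rfl⟩ := hcov' j ⟨j, hj, le_rfl⟩ fun h => hi' (htl hij h)
      exact ⟨e j, (hv j).2 hj, le_of_not_gt fun h => hij.not_gt ((hlt _ _).1 h)⟩
  have hdiff : (reach π v \ t).ncard = (reach π' v \ t).ncard := by
    have h1 : reach π v \ t = e '' {i | e i ∈ reach π v \ t} := by
      ext x
      constructor
      · intro hx
        obtain ⟨i, rfl⟩ := hcov x hx.1 hx.2
        exact ⟨i, hx, rfl⟩
      · rintro ⟨i, hi, rfl⟩
        exact hi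
    have h2 : reach π' v \ t = e' '' {i | e i ∈ reach π v \ t} := by
      ext x
      constructor
      · intro hx
        obtain ⟨i, rfl⟩ := hcov' x hx.1 hx.2
        exact ⟨i, ⟨(key i).2 hx.1, fun h => hx.2 ((ht i).1 h)⟩, rfl⟩
      · rintro ⟨i, hi, rfl⟩
        exact ⟨(key i).1 hi.1, fun h => hi.2 ((ht i).2 h)⟩
    rw [h2, Set.ncard_image_of_injective _ he', ← Set.ncard_image_of_injective _ he, ← h1]
  refine ⟨?_, key, ?_⟩
  · ext i
    refine mem_iff_mem_of_ncard_eq (x := id) (x' := id) (fun _ _ => Iff.rfl)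
      (isLowerSet_reach π v) (isLowerSet_reach π' v) ?_ i
    change (reach π v).ncard = (reach π' v).ncard
    rw [← Set.ncard_sdiff_add_ncard_of_subset hsub, ← Set.ncard_sdiff_add_ncard_of_subset hsub',
      hdiff]
  · intro i
    have h1 : g i ∈ reach π v → g i ∈ t := fun h => by
      by_contra hn
      obtain ⟨j, hj⟩ := hcov _ h hn
      exact hdisj _ _ hj
    have h2 : g' i ∈ reach π' v → g' i ∈ t := fun h => by
      by_contra hn
      obtain ⟨j, hj⟩ := hcov' _ h hn
      exact hdisj' _ _ hj
    exact ⟨fun h => hsub' ((hgt i).1 (h1 h)), fun h => hsub ((hgt i).2 (h2 h))⟩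

variable [LinearOrder B]

/-- The elements entering the chain are coloured as in `BluePos` and `BlueVal`: `g` enumerates
blue ones and `e` the others. -/
structure Coloured (π : A ≃ B) (s : Set A × Set B) (e : ι → A) (g : κ → A) : Prop where
  start : ChainStart π s
  inj_red : Function.Injective e
  inj_blue : Function.Injective g
  disjoint : ∀ i j, e i ≠ g j
  pos_red : ∀ k i, Odd k → EntersPos π s k i → i ∈ Set.range e
  pos_blue : ∀ k i, Even k → EntersPos π s k i → i ∈ Set.range g
  val_red : ∀ k i, Even k → EntersVal π s k (π i) → i ∈ Set.range e
  val_blue : ∀ k i, Odd k → EntersVal π s k (π i) → i ∈ Set.range g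

theorem Coloured.chain_eq [Finite B] {π π' : A ≃ B} {s : Set A × Set B} {e e' : ι → A}
    {g g' : κ → A} (h : Coloured π s e g) (h' : Coloured π' s e' g')
    (het : ∀ i j, e i < e j ↔ e' i < e' j) (hgt : ∀ i j, g i < g j ↔ g' i < g' j)
    (hev : ∀ i j, π (e i) < π (e j) ↔ π' (e' i) < π' (e' j))
    (hgv : ∀ i j, π (g i) < π (g j) ↔ π' (g' i) < π' (g' j))
    (het0 : ∀ i, e i ∈ s.1 ↔ e' i ∈ s.1) (hgt0 : ∀ i, g i ∈ s.1 ↔ g' i ∈ s.1)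
    (hev0 : ∀ i, π (e i) ∈ s.2 ↔ π' (e' i) ∈ s.2) (hgv0 : ∀ i, π (g i) ∈ s.2 ↔ π' (g' i) ∈ s.2)
    (k : ℕ) : chain π s k = chain π' s k := by
  -- The induction must also carry which elements of each part have been reached, since the next
  -- step is computed from that.
  suffices H : chain π s k = chain π' s k ∧
      (∀ i, e i ∈ (chain π s k).1 ↔ e' i ∈ (chain π' s k).1) ∧
      (∀ i, g i ∈ (chain π s k).1 ↔ g' i ∈ (chain π' s k).1) ∧
      (∀ i, π (e i) ∈ (chain π s k).2 ↔ π' (e' i) ∈ (chain π' s k).2) ∧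
      (∀ i, π (g i) ∈ (chain π s k).2 ↔ π' (g' i) ∈ (chain π' s k).2) from H.1
  induction k with
  | zero => exact ⟨rfl, het0, hgt0, hev0, hgv0⟩
  | succ k ih =>
    obtain ⟨hc, h1, h2, h3, h4⟩ := ih
    have hs := h.start.succ_subset k
    have hs' := h'.start.succ_subset k
    have hl := h.start.lower k
    have pr := h.pos_red k
    have pr' := h'.pos_red k
    have pb := h.pos_blue k
    have pb' := h'.pos_blue k
    have vr := h.val_red k
    have vr' := h'.val_red k
    have vb := h.val_blue k
    have vb' := h'.val_blue k
    simp only [EntersPos, EntersVal, chain] at hs hs' pr pr' pb pb' vr vr' vb vb' ⊢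
    rw [← hc] at h1 h2 h3 h4 hs' pr' pb' vr' vb' ⊢
    generalize (chain π s k).1 = t at *
    generalize (chain π s k).2 = v at *
    -- At an even index new positions are blue and new values red; at an odd index the roles are
    -- exchanged.
    rcases Nat.even_or_odd k with hk | hk
    · obtain ⟨q1, q2, q3⟩ := reach_eq_reach h.inj_blue h'.inj_blue hgt
        (fun i j => (h.disjoint j i).symm) (fun i j => (h'.disjoint j i).symm)
        h2 h4 h1 hl.1 hs.1 hs'.1 (fun i a b => pb i hk ⟨a, b⟩) (fun i a b => pb' i hk ⟨a, b⟩)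
      obtain ⟨r1, r2, r3⟩ := reach_eq_reach (π := π.symm) (π' := π'.symm)
        (e := fun i => π (e i)) (e' := fun i => π' (e' i))
        (g := fun i => π (g i)) (g' := fun i => π' (g' i))
        (π.injective.comp h.inj_red) (π'.injective.comp h'.inj_red) hev
        (fun i j => by simpa using h.disjoint i j) (fun i j => by simpa using h'.disjoint i j)
        h3 (by simpa using h1) h4 hl.2 hs.2 hs'.2
        (mem_range_of_symm fun i a => vr i hk a) (mem_range_of_symm fun i a => vr' i hk a)
      exact ⟨by rw [q1, r1], q3, q2, r2, r3⟩
    · obtain ⟨q1, q2, q3⟩ := reach_eq_reach h.inj_red h'.inj_red het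
        h.disjoint h'.disjoint
        h1 h3 h2 hl.1 hs.1 hs'.1 (fun i a b => pr i hk ⟨a, b⟩) (fun i a b => pr' i hk ⟨a, b⟩)
      obtain ⟨r1, r2, r3⟩ := reach_eq_reach (π := π.symm) (π' := π'.symm)
        (e := fun i => π (g i)) (e' := fun i => π' (g' i))
        (g := fun i => π (e i)) (g' := fun i => π' (e' i))
        (π.injective.comp h.inj_blue) (π'.injective.comp h'.inj_blue) hgv
        (fun i j => by simpa using (h.disjoint j i).symm)
        (fun i j => by simpa using (h'.disjoint j i).symm)
        h4 (by simpa using h2) h3 hl.2 hs.2 hs'.2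
        (mem_range_of_symm fun i a => vb i hk a) (mem_range_of_symm fun i a => vb' i hk a)
      exact ⟨by rw [q1, r1], q2, q3, r3, r2⟩

end Determinacy

/-! ### The colouring generated by an inversion -/

section Inversion

variable {A B : Type*} [LinearOrder A] [LinearOrder B]

/-- The starting data of the chain generated by an inversion at positions `p < q`. -/
def inversionStart (π : A ≃ B) (p q : A) : Set A × Set B := (Set.Iic q, Set.Iic (π p))

variable {π π' : A ≃ B} {p q : A}

theorem chainStart_inversionStart (hpq : p < q) (hv : π q < π p) :
    ChainStart π (inversionStart π p q) where
  lower_fst := isLowerSet_Iic q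
  lower_snd := isLowerSet_Iic (π p)
  fst_subset := fun _ hi => ⟨q, hv.le, hi⟩
  snd_subset := fun _ hb => ⟨π p, by simpa [inversionStart] using hpq.le, hb⟩

/-- An element right of `q` with value below `π p` enters by position at index 0, an even index; any
other one is outside both starting segments, where the two colourings agree. -/
theorem bluePos_iff_of_lt (hπ : No321 π) (hpq : p < q) (hv : π q < π p) {i : A} (hi : q < i) :
    BluePos π (inversionStart π p q) i ↔
      π i < π p ∨ BlueVal π (inversionStart π p q) (π i) := by
  have hs := chainStart_inversionStart hpq hv
  have hi' : i ∉ (inversionStart π p q).1 := not_le_of_gt hi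
  rcases lt_or_ge (π p) (π i) with h | h
  · rw [bluePos_iff_blueVal hs hπ hi' (not_le_of_gt h)]
    simp [h.not_gt]
  · have hne : π i ≠ π p := fun h => (hpq.trans hi).ne' (π.injective h)
    refine iff_of_true ⟨0, Even.zero, ⟨i, h, le_rfl⟩, hi'⟩ (Or.inl (lt_of_le_of_ne h hne))

theorem not_blueVal_of_le (hpq : p < q) (hv : π q < π p) {i : A} (hi : i ≤ q) :
    ¬ BlueVal π (inversionStart π p q) (π i) := by
  rintro ⟨k, hk, hki⟩
  have hs := chainStart_inversionStart hpq hv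
  have : EntersVal π (inversionStart π p q) 0 (π i) :=
    ⟨⟨π i, by simpa [chain, inversionStart] using hi, le_rfl⟩, hki.notMem_start hs⟩
  rw [hki.unique hs this] at hk
  simp at hk

theorem BluePos.lt (hpq : p < q) (hv : π q < π p) {i : A}
    (h : BluePos π (inversionStart π p q) i) : q < i := by
  obtain ⟨k, -, hk⟩ := h
  exact lt_of_not_ge (hk.notMem_start (chainStart_inversionStart hpq hv))

theorem BlueVal.lt (hpq : p < q) (hv : π q < π p) {b : B}
    (h : BlueVal π (inversionStart π p q) b) : π p < b := by
  obtain ⟨k, -, hk⟩ := h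
  exact lt_of_not_ge (hk.notMem_start (chainStart_inversionStart hpq hv))

/-- `π` with the orders of positions and values both reversed. -/
def dualEquiv (π : A ≃ B) : Aᵒᵈ ≃ Bᵒᵈ := OrderDual.ofDual.trans (π.trans OrderDual.toDual)

omit [LinearOrder A] [LinearOrder B] in
@[simp] theorem dualEquiv_toDual (π : A ≃ B) (i : A) :
    dualEquiv π (OrderDual.toDual i) = OrderDual.toDual (π i) := rfl

theorem No321.dual (h : No321 π) : No321 (dualEquiv π) := by
  intro i j k hij hjk h1 h2
  exact h (OrderDual.ofDual k) (OrderDual.ofDual j) (OrderDual.ofDual i) hjk hij h2 h1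

/-- The starting data of the chain generated downwards by an inversion. -/
abbrev dualStart (π : A ≃ B) (p q : A) : Set Aᵒᵈ × Set Bᵒᵈ :=
  inversionStart (dualEquiv π) (OrderDual.toDual q) (OrderDual.toDual p)

/-- The positions coloured blue by the inversion at positions `p < q`. -/
def Blue (π : A ≃ B) (p q i : A) : Prop :=
  BluePos π (inversionStart π p q) i ∨
    BluePos (dualEquiv π) (dualStart π p q) (OrderDual.toDual i)

/-- The values coloured blue by the inversion at positions `p < q`. -/
def BlueValue (π : A ≃ B) (p q : A) (b : B) : Prop :=
  (π q < b ∧ b < π p) ∨ BlueVal π (inversionStart π p q) b ∨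
    BlueVal (dualEquiv π) (dualStart π p q) (OrderDual.toDual b)

theorem Blue.lt_or_lt (hpq : p < q) (hv : π q < π p) {i : A} (h : Blue π p q i) :
    i < p ∨ q < i := by
  rcases h with h | h
  · exact Or.inr (h.lt hpq hv)
  · exact Or.inl (BluePos.lt (π := dualEquiv π) (p := OrderDual.toDual q)
      (q := OrderDual.toDual p) hpq hv h)

theorem not_dual_bluePos_of_le (hpq : p < q) (hv : π q < π p) {i : A} (hi : p ≤ i) :
    ¬ BluePos (dualEquiv π) (dualStart π p q) (OrderDual.toDual i) := fun h =>
  (BluePos.lt (π := dualEquiv π) (p := OrderDual.toDual q)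
      (q := OrderDual.toDual p) hpq hv h).not_ge hi

theorem not_dual_blueVal_of_le (hpq : p < q) (hv : π q < π p) {b : B} (hi : π q ≤ b) :
    ¬ BlueVal (dualEquiv π) (dualStart π p q) (OrderDual.toDual b) := fun h =>
  (BlueVal.lt (π := dualEquiv π) (p := OrderDual.toDual q)
      (q := OrderDual.toDual p) hpq hv h).not_ge hi

/-- Avoidance of 321 puts elements right of `q` above `π q` and those left of `p` below `π p`, so
each side involves one chain only. An element between `p` and `q` in position cannot also be between
them in value, and neither chain colours it. -/
theorem blue_iff_blueValue (hπ : No321 π) (hpq : p < q) (hv : π q < π p) {i : A}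
    (hip : i ≠ p) (hiq : i ≠ q) : Blue π p q i ↔ BlueValue π p q (π i) := by
  have hvp : π i ≠ π p := fun h => hip (π.injective h)
  have hvq : π i ≠ π q := fun h => hiq (π.injective h)
  rcases lt_or_gt_of_ne hiq with hiq | hiq
  · rcases lt_or_gt_of_ne hip with hip | hip
    · have h1 : π i < π p := lt_of_le_of_ne (le_of_not_gt fun h => hπ i p q hip hpq h hv) hvp
      have h2 := bluePos_iff_of_lt (π := dualEquiv π) (p := OrderDual.toDual q)
        (q := OrderDual.toDual p) (i := OrderDual.toDual i) hπ.dual hpq hv hip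
      have h3 : ¬ BluePos π (inversionStart π p q) i := fun h => (h.lt hpq hv).not_gt hiq
      have h4 := not_blueVal_of_le hpq hv hiq.le
      have h5 : dualEquiv π (OrderDual.toDual i) < dualEquiv π (OrderDual.toDual q) ↔
        π q < π i := Iff.rfl
      rw [h5] at h2
      simp only [Blue, BlueValue, h3, h4, h1, false_or, and_true]
      exact h2
    · have h1 : ¬ Blue π p q i := fun h => (h.lt_or_lt hpq hv).elim hip.not_gt hiq.not_gt
      refine iff_of_false h1 ?_
      rintro (h | h | h)
      · exact hπ p i q hip hiq h.2 h.1
      · exact not_blueVal_of_le hpq hv hiq.le h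
      · exact not_blueVal_of_le (π := dualEquiv π) (p := OrderDual.toDual q)
          (q := OrderDual.toDual p) (i := OrderDual.toDual i) hpq hv hip.le h
  · have hip : p < i := hpq.trans hiq
    have h1 : π q < π i :=
      lt_of_le_of_ne (le_of_not_gt fun h => hπ p q i hpq hiq hv h) hvq.symm
    have h2 := bluePos_iff_of_lt hπ hpq hv hiq
    have h3 := not_dual_bluePos_of_le hpq hv hip.le
    have h4 := not_dual_blueVal_of_le hpq hv h1.le
    simp only [Blue, BlueValue, h3, h4, h1, or_false, true_and]
    exact h2

/-- The predicate `P` is kept abstract so that the lemma serves both the upward and the dual chain: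
beyond the starting segments of either, `Blue` reduces to the colour given by that chain. -/
theorem coloured_of_forall {ι κ : Type*} {P : A → Prop} {e : ι → A} {g : κ → A}
    (hpq : p < q) (hv : π q < π p) (he : Function.Injective e) (hg : Function.Injective g)
    (hre : Set.range e = {i | i ≠ p ∧ i ≠ q ∧ ¬ P i}) (hrg : Set.range g = {i | P i})
    (hpos : ∀ i, q < i → (P i ↔ BluePos π (inversionStart π p q) i))
    (hval : ∀ i, π p < π i → (P i ↔ BlueVal π (inversionStart π p q) (π i))) :
    Coloured π (inversionStart π p q) e g := by
  have hs := chainStart_inversionStart hpq hv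
  have hp : ∀ k i, EntersPos π (inversionStart π p q) k i → q < i := fun k i h =>
    lt_of_not_ge (h.notMem_start hs)
  have hv' : ∀ k i, EntersVal π (inversionStart π p q) k (π i) → π p < π i := fun k i h =>
    lt_of_not_ge (h.notMem_start hs)
  refine ⟨hs, he, hg, fun i j hij => ?_, fun k i hk hi => ?_, fun k i hk hi => ?_,
    fun k i hk hi => ?_, fun k i hk hi => ?_⟩
  · have h1 : e i ∈ Set.range e := ⟨i, rfl⟩
    have h2 : g j ∈ Set.range g := ⟨j, rfl⟩
    rw [hre] at h1
    rw [hrg] at h2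
    exact h1.2.2 (hij ▸ h2)
  · rw [hre]
    refine ⟨(hpq.trans (hp k i hi)).ne', (hp k i hi).ne', ?_⟩
    rw [hpos i (hp k i hi)]
    rintro ⟨l, hl, hl'⟩
    rw [hi.unique hs hl'] at hk
    exact Nat.not_odd_iff_even.2 hl hk
  · rw [hrg]
    exact (hpos i (hp k i hi)).2 ⟨k, hk, hi⟩
  · rw [hre]
    have := hv' k i hi
    refine ⟨by rintro rfl; exact this.false, by rintro rfl; exact this.not_gt hv, ?_⟩
    rw [hval i this]
    rintro ⟨l, hl, hl'⟩
    rw [hi.unique hs hl'] at hk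
    exact Nat.not_odd_iff_even.2 hk hl
  · rw [hrg]
    exact (hval i (hv' k i hi)).2 ⟨k, hk, hi⟩

/-- `e` enumerates the non-blue and `g` the blue elements other than those of the inversion at
positions `p < q`. -/
structure CutAt {ι κ : Type*} (π : A ≃ B) (p q : A) (e : ι → A) (g : κ → A) : Prop where
  no321 : No321 π
  lt : p < q
  inv : π q < π p
  inj_red : Function.Injective e
  inj_blue : Function.Injective g
  range_red : Set.range e = {i | i ≠ p ∧ i ≠ q ∧ ¬ Blue π p q i}
  range_blue : Set.range g = {i | Blue π p q i}

variable {ι κ : Type*} {e e' : ι → A} {g g' : κ → A}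

theorem CutAt.coloured (h : CutAt π p q e g) : Coloured π (inversionStart π p q) e g := by
  refine coloured_of_forall h.lt h.inv h.inj_red h.inj_blue h.range_red h.range_blue
    (fun i hi => ?_) fun i hi => ?_
  · simp [Blue, not_dual_bluePos_of_le h.lt h.inv (h.lt.trans hi).le]
  · rw [blue_iff_blueValue h.no321 h.lt h.inv (by rintro rfl; exact hi.false)
      (by rintro rfl; exact hi.not_gt h.inv)]
    simp [BlueValue, not_dual_blueVal_of_le h.lt h.inv (h.inv.trans hi).le, hi.not_gt]

theorem CutAt.coloured_dual (h : CutAt π p q e g) :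
    Coloured (dualEquiv π) (dualStart π p q) (fun i => OrderDual.toDual (e i))
      (fun i => OrderDual.toDual (g i)) := by
  refine coloured_of_forall (P := fun i => Blue π p q (OrderDual.ofDual i)) h.lt h.inv
    (OrderDual.toDual.injective.comp h.inj_red) (OrderDual.toDual.injective.comp h.inj_blue) ?_
    h.range_blue (fun i hi => ?_) fun i hi => ?_
  · refine Eq.trans h.range_red ?_
    ext i
    exact ⟨fun ⟨a, b, c⟩ => ⟨b, a, c⟩, fun ⟨a, b, c⟩ => ⟨b, a, c⟩⟩
  · have hi' : OrderDual.ofDual i < p := hi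
    have : ¬ BluePos π (inversionStart π p q) (OrderDual.ofDual i) := fun hb =>
      (hb.lt h.lt h.inv).not_gt (hi'.trans h.lt)
    simp [Blue, this]
  · have hi' : π (OrderDual.ofDual i) < π q := hi
    rw [blue_iff_blueValue h.no321 h.lt h.inv
      (fun hp => by rw [hp] at hi'; exact hi'.not_gt h.inv)
      (fun hp => by rw [hp] at hi'; exact hi'.false)]
    have : ¬ BlueVal π (inversionStart π p q) (π (OrderDual.ofDual i)) := fun hb =>
      (hb.lt h.lt h.inv).not_gt (hi'.trans h.inv)
    simp only [BlueValue, this, hi'.not_gt, false_and, false_or]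
    rfl

theorem CutAt.not_between_pos (h : CutAt π p q e g) (i : κ) : g i < p ∨ q < g i := by
  have : g i ∈ Set.range g := ⟨i, rfl⟩
  rw [h.range_blue] at this
  exact this.lt_or_lt h.lt h.inv

theorem CutAt.not_between_val (h : CutAt π p q e g) (i : ι) :
    π (e i) < π q ∨ π p < π (e i) := by
  have hi : e i ∈ Set.range e := ⟨i, rfl⟩
  rw [h.range_red] at hi
  obtain ⟨h1, h2, h3⟩ := hi
  rw [blue_iff_blueValue h.no321 h.lt h.inv h1 h2] at h3
  have hvp : π (e i) ≠ π p := fun h => h1 (π.injective h)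
  have hvq : π (e i) ≠ π q := fun h => h2 (π.injective h)
  rcases lt_or_gt_of_ne hvq with h4 | h4
  · exact Or.inl h4
  · exact Or.inr (lt_of_le_of_ne (le_of_not_gt fun h5 => h3 (Or.inl ⟨h4, h5⟩)) hvp.symm)

theorem CutAt.blue_eq [Finite A] [Finite B] (h : CutAt π p q e g) (h' : CutAt π' p q e' g')
    (hp : π p = π' p) (hq : π q = π' q)
    (het : ∀ i j, e i < e j ↔ e' i < e' j) (hgt : ∀ i j, g i < g j ↔ g' i < g' j)
    (hev : ∀ i j, π (e i) < π (e j) ↔ π' (e' i) < π' (e' j))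
    (hgv : ∀ i j, π (g i) < π (g j) ↔ π' (g' i) < π' (g' j))
    (heq : ∀ i, e i ≤ q ↔ e' i ≤ q) (hgq : ∀ i, g i ≤ q ↔ g' i ≤ q)
    (hep : ∀ i, e i < p ↔ e' i < p) (hgp : ∀ i, g i < p ↔ g' i < p)
    (hevp : ∀ i, π (e i) ≤ π p ↔ π' (e' i) ≤ π p) (hgvp : ∀ i, π (g i) ≤ π p ↔ π' (g' i) ≤ π p)
    (hevq : ∀ i, π (e i) < π q ↔ π' (e' i) < π q) (hgvq : ∀ i, π (g i) < π q ↔ π' (g' i) < π q) :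
    Blue π p q = Blue π' p q ∧ BlueValue π p q = BlueValue π' p q := by
  have hs : inversionStart π' p q = inversionStart π p q := by simp [inversionStart, hp]
  have hd : dualStart π' p q = dualStart π p q := by
    simp [dualStart, inversionStart, hq]
  have hc' := h'.coloured
  have hcd' := h'.coloured_dual
  rw [hs] at hc'
  rw [hd] at hcd'
  have h1 := h.coloured.chain_eq hc' het hgt hev hgv heq hgq hevp hgvp
  -- The dual chain starts from the positions at least `p` and the values at least `π q`, the
  -- complements of the sets in the hypotheses.
  have h2 := h.coloured_dual.chain_eq hcd' (fun i j => het j i) (fun i j => hgt j i)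
    (fun i j => hev j i) (fun i j => hgv j i)
    (fun i => (not_lt.symm.trans (not_congr (hep i))).trans not_lt)
    (fun i => (not_lt.symm.trans (not_congr (hgp i))).trans not_lt)
    (fun i => (not_lt.symm.trans (not_congr (hevq i))).trans not_lt)
    (fun i => (not_lt.symm.trans (not_congr (hgvq i))).trans not_lt)
  constructor
  · funext i
    simp only [Blue, BluePos, EntersPos, hs, hd, h1, h2]
  · funext b
    simp only [BlueValue, BlueVal, EntersVal, hs, hd, h1, h2, hp, hq]

end Inversion

/-! ### Reconstructing a permutation from its parts -/

section Patterns

theorem Embedding.injective {σ π : FinPerm} (e : Embedding σ π) : Function.Injective e.toFun := by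
  intro i j hij
  by_contra hne
  rcases lt_or_gt_of_ne hne with h | h
  · exact ((e.position_lt_iff _ _).2 h).ne hij
  · exact ((e.position_lt_iff _ _).2 h).ne hij.symm

/-- Composition of embeddings. -/
def Embedding.trans {σ τ π : FinPerm} (e : Embedding σ τ) (f : Embedding τ π) :
    Embedding σ π where
  toFun := fun i => f.toFun (e.toFun i)
  position_lt_iff := fun i j => by rw [f.position_lt_iff, e.position_lt_iff]
  value_lt_iff := fun i j => by rw [f.value_lt_iff, e.value_lt_iff]

/-- Every set of positions of a permutation carries a pattern. -/
theorem exists_embedding_range_eq (π : FinPerm) (S : Set (Fin π.1)) :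
    ∃ (ρ : FinPerm) (e : Embedding ρ π), Set.range e.toFun = S ∧ ρ.1 = S.ncard := by
  classical
  obtain ⟨n, π⟩ := π
  have hV : (S.toFinset.map π.toEmbedding).card = S.toFinset.card := Finset.card_map _
  let x : Fin S.toFinset.card ↪o Fin n := S.toFinset.orderEmbOfFin rfl
  have hx : ∀ i, x i ∈ S.toFinset := S.toFinset.orderEmbOfFin_mem rfl
  let y := (S.toFinset.map π.toEmbedding).orderIsoOfFin hV
  let f : Fin S.toFinset.card → Fin S.toFinset.card := fun i =>
    y.symm ⟨π (x i), Finset.mem_map_of_mem π.toEmbedding (hx i)⟩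
  have hf : ∀ i j, π (x i) < π (x j) ↔ f i < f j := fun i j => by
    simp only [f, OrderIso.lt_iff_lt]
    rfl
  have hinj : Function.Injective f := fun i j hij => by
    have := y.symm.injective hij
    simpa using this
  refine ⟨⟨S.toFinset.card, Equiv.ofBijective f (Finite.injective_iff_bijective.1 hinj)⟩,
    ⟨x, fun i j => x.lt_iff_lt, hf⟩, ?_, ?_⟩
  · simp [x]
  · exact (Set.ncard_eq_toFinset_card' S).symm

/-- A strictly monotone map is determined by its range; this is applied to the positions and to the
values listed in increasing order. -/
theorem eq_of_range_eq {n : ℕ} {π π' : Equiv.Perm (Fin n)} {ρ : FinPerm}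
    (e : Embedding ρ ⟨n, π⟩) (e' : Embedding ρ ⟨n, π'⟩)
    (hr : Set.range e.toFun = Set.range e'.toFun)
    (hv : π '' Set.range e.toFun = π' '' Set.range e'.toFun) {i : Fin n}
    (hi : i ∈ Set.range e.toFun) : π i = π' i := by
  have h1 : e.toFun = e'.toFun := (StrictMono.range_inj (fun i j h => (e.position_lt_iff i j).2 h)
    (fun i j h => (e'.position_lt_iff i j).2 h)).1 hr
  have h2 : (fun j => π (e.toFun (ρ.2.symm j))) = fun j => π' (e'.toFun (ρ.2.symm j)) := by
    refine (StrictMono.range_inj (fun i j h => (e.value_lt_iff _ _).2 (by simpa using h))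
      (fun i j h => (e'.value_lt_iff _ _).2 (by simpa using h))).1 ?_
    have h3 : ∀ z : Fin ρ.1 → Fin n, Set.range (fun j => z (ρ.2.symm j)) = Set.range z :=
      fun z => EquivLike.range_comp z ρ.2.symm
    rw [h3 fun j => π (e.toFun j), h3 fun j => π' (e'.toFun j)]
    rw [← Set.range_comp, ← Set.range_comp] at hv
    exact hv
  obtain ⟨j, rfl⟩ := hi
  have h4 := congrFun h2 (ρ.2 j)
  simp only [Equiv.symm_apply_apply] at h4
  rw [h4, h1]

/-- The numerical data that determine a permutation cut at an inversion from its two parts. -/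
noncomputable def cutKey {n a b : ℕ} (π : Equiv.Perm (Fin n)) (p q : Fin n) (e : Fin a → Fin n)
    (g : Fin b → Fin n) : Fin 12 → ℕ :=
  ![p, q, π p, π q, {i | e i ≤ q}.ncard, {i | g i ≤ q}.ncard, {i | e i < p}.ncard,
    {i | g i < p}.ncard, {i | π (e i) ≤ π p}.ncard, {i | π (g i) ≤ π p}.ncard,
    {i | π (e i) < π q}.ncard, {i | π (g i) < π q}.ncard]

/-- Four entries of the key locate the inversion. The other eight say how many elements of each part
lie in the starting segments of the two chains or in their complements, which is all that
`CutAt.blue_eq` needs. -/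
theorem CutAt.eq_of_cutKey_eq {n : ℕ} {π π' : Equiv.Perm (Fin n)} {ρ τ : FinPerm}
    {p q p' q' : Fin n} {e : Embedding ρ ⟨n, π⟩} {g : Embedding τ ⟨n, π⟩}
    {e' : Embedding ρ ⟨n, π'⟩} {g' : Embedding τ ⟨n, π'⟩}
    (h : CutAt π p q e.toFun g.toFun) (h' : CutAt π' p' q' e'.toFun g'.toFun)
    (hk : cutKey π p q e.toFun g.toFun = cutKey π' p' q' e'.toFun g'.toFun) : π = π' := by
  have hp : p = p' := Fin.ext (congrFun hk 0)
  have hq : q = q' := Fin.ext (congrFun hk 1)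
  subst hp hq
  have hvp : π p = π' p := Fin.ext (congrFun hk 2)
  have hvq : π q = π' q := Fin.ext (congrFun hk 3)
  have het : ∀ i j, e.toFun i < e.toFun j ↔ e'.toFun i < e'.toFun j := fun i j =>
    (e.position_lt_iff i j).trans (e'.position_lt_iff i j).symm
  have hgt : ∀ i j, g.toFun i < g.toFun j ↔ g'.toFun i < g'.toFun j := fun i j =>
    (g.position_lt_iff i j).trans (g'.position_lt_iff i j).symm
  have hev : ∀ i j, π (e.toFun i) < π (e.toFun j) ↔ π' (e'.toFun i) < π' (e'.toFun j) :=
    fun i j => (e.value_lt_iff i j).trans (e'.value_lt_iff i j).symm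
  have hgv : ∀ i j, π (g.toFun i) < π (g.toFun j) ↔ π' (g'.toFun i) < π' (g'.toFun j) :=
    fun i j => (g.value_lt_iff i j).trans (g'.value_lt_iff i j).symm
  have h8 : {i | π (e.toFun i) ≤ π p}.ncard = {i | π' (e'.toFun i) ≤ π' p}.ncard := congrFun hk 8
  have h9 : {i | π (g.toFun i) ≤ π p}.ncard = {i | π' (g'.toFun i) ≤ π' p}.ncard := congrFun hk 9
  have h10 : {i | π (e.toFun i) < π q}.ncard = {i | π' (e'.toFun i) < π' q}.ncard :=
    congrFun hk 10
  have h11 : {i | π (g.toFun i) < π q}.ncard = {i | π' (g'.toFun i) < π' q}.ncard :=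
    congrFun hk 11
  rw [← hvp] at h8 h9
  rw [← hvq] at h10 h11
  obtain ⟨hb, hbv⟩ := h.blue_eq h' hvp hvq het hgt hev hgv
    (mem_iff_mem_of_ncard_eq het (isLowerSet_Iic q) (isLowerSet_Iic q) (congrFun hk 4))
    (mem_iff_mem_of_ncard_eq hgt (isLowerSet_Iic q) (isLowerSet_Iic q) (congrFun hk 5))
    (mem_iff_mem_of_ncard_eq het (isLowerSet_Iio p) (isLowerSet_Iio p) (congrFun hk 6))
    (mem_iff_mem_of_ncard_eq hgt (isLowerSet_Iio p) (isLowerSet_Iio p) (congrFun hk 7))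
    (mem_iff_mem_of_ncard_eq hev (isLowerSet_Iic (π p)) (isLowerSet_Iic (π p)) h8)
    (mem_iff_mem_of_ncard_eq hgv (isLowerSet_Iic (π p)) (isLowerSet_Iic (π p)) h9)
    (mem_iff_mem_of_ncard_eq hev (isLowerSet_Iio (π q)) (isLowerSet_Iio (π q)) h10)
    (mem_iff_mem_of_ncard_eq hgv (isLowerSet_Iio (π q)) (isLowerSet_Iio (π q)) h11)
  have hre : Set.range e.toFun = Set.range e'.toFun := by rw [h.range_red, h'.range_red, hb]
  have hrg : Set.range g.toFun = Set.range g'.toFun := by rw [h.range_blue, h'.range_blue, hb]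
  -- The colour of a value is given by `BlueValue`, which is now common to both permutations; so the
  -- value sets of the two parts agree as well as their positions.
  have red_val : ∀ {σ : Equiv.Perm (Fin n)}, No321 σ → σ q < σ p →
      σ '' {i | i ≠ p ∧ i ≠ q ∧ ¬ Blue σ p q i} =
        {b | b ≠ σ p ∧ b ≠ σ q ∧ ¬ BlueValue σ p q b} := by
    intro σ hσ hi
    ext b
    obtain ⟨i, rfl⟩ := σ.surjective b
    simp only [Set.mem_image, Set.mem_ofPred_eq, EmbeddingLike.apply_eq_iff_eq, exists_eq_right,
      ne_eq]
    exact and_congr_right fun h1 => and_congr_right fun h2 =>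
      not_congr (blue_iff_blueValue hσ h.lt hi h1 h2)
  have blue_val : ∀ {σ : Equiv.Perm (Fin n)}, No321 σ → σ q < σ p →
      σ '' {i | Blue σ p q i} = {b | b ≠ σ p ∧ b ≠ σ q ∧ BlueValue σ p q b} := by
    intro σ hσ hi
    ext b
    obtain ⟨i, rfl⟩ := σ.surjective b
    simp only [Set.mem_image, Set.mem_ofPred_eq, EmbeddingLike.apply_eq_iff_eq, exists_eq_right,
      ne_eq]
    constructor
    · intro hB
      have h1 : i ≠ p := by
        rintro rfl
        exact (hB.lt_or_lt h.lt hi).elim (lt_irrefl _) h.lt.not_gt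
      have h2 : i ≠ q := by
        rintro rfl
        exact (hB.lt_or_lt h.lt hi).elim h.lt.not_gt (lt_irrefl _)
      exact ⟨h1, h2, (blue_iff_blueValue hσ h.lt hi h1 h2).1 hB⟩
    · rintro ⟨h1, h2, h3⟩
      exact (blue_iff_blueValue hσ h.lt hi h1 h2).2 h3
  have hve : π '' Set.range e.toFun = π' '' Set.range e'.toFun := by
    rw [h.range_red, h'.range_red, red_val h.no321 h.inv, red_val h'.no321 h'.inv, hbv, hvp, hvq]
  have hvg : π '' Set.range g.toFun = π' '' Set.range g'.toFun := by
    rw [h.range_blue, h'.range_blue, blue_val h.no321 h.inv, blue_val h'.no321 h'.inv, hbv, hvp,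
      hvq]
  ext1 i
  by_cases h1 : i = p
  · rw [h1, hvp]
  by_cases h2 : i = q
  · rw [h2, hvq]
  by_cases h3 : Blue π p q i
  · exact eq_of_range_eq g g' hrg hvg (by rw [h.range_blue]; exact h3)
  · exact eq_of_range_eq e e' hre hve (by rw [h.range_red]; exact ⟨h1, h2, h3⟩)

theorem cutKey_le {n a b : ℕ} (π : Equiv.Perm (Fin n)) (p q : Fin n) (e : Fin a → Fin n)
    (g : Fin b → Fin n) (ha : a ≤ n) (hb : b ≤ n) (i : Fin 12) : cutKey π p q e g i ≤ n := by
  have h1 : ∀ s : Set (Fin a), s.ncard ≤ n := fun s =>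
    (Set.ncard_le_card s).trans (by simpa using ha)
  have h2 : ∀ s : Set (Fin b), s.ncard ≤ n := fun s =>
    (Set.ncard_le_card s).trans (by simpa using hb)
  fin_cases i
  all_goals first
    | exact h1 _
    | exact h2 _
    | exact Fin.is_le'

theorem exists_cutAt {n : ℕ} {π : Equiv.Perm (Fin n)} (hπ : No321 π) {p q : Fin n} (hpq : p < q)
    (hv : π q < π p) : ∃ (ρ τ : FinPerm) (e : Embedding ρ ⟨n, π⟩) (g : Embedding τ ⟨n, π⟩),
      CutAt π p q e.toFun g.toFun ∧ ρ.1 + τ.1 ≤ n := by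
  obtain ⟨ρ, e, he, hρ⟩ := exists_embedding_range_eq ⟨n, π⟩ {i | i ≠ p ∧ i ≠ q ∧ ¬ Blue π p q i}
  obtain ⟨τ, g, hg, hτ⟩ := exists_embedding_range_eq ⟨n, π⟩ {i | Blue π p q i}
  refine ⟨ρ, τ, e, g, ⟨hπ, hpq, hv, e.injective, g.injective, he, hg⟩, ?_⟩
  rw [hρ, hτ, ← Set.ncard_union_eq]
  · exact (Set.ncard_le_card _).trans (by simp)
  · rw [Set.disjoint_left]
    exact fun i h1 h2 => h1.2.2 h2

theorem eq_of_embedding_compl_singleton {n : ℕ} {π π' : Equiv.Perm (Fin n)} {ρ : FinPerm}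
    {p : Fin n} (hp : π p = π' p) (e : Embedding ρ ⟨n, π⟩) (e' : Embedding ρ ⟨n, π'⟩)
    (he : Set.range e.toFun = {p}ᶜ) (he' : Set.range e'.toFun = {p}ᶜ) : π = π' := by
  ext1 i
  by_cases hi : i = p
  · rw [hi, hp]
  refine eq_of_range_eq e e' (he.trans he'.symm) ?_ (by rw [he]; exact hi)
  rw [he, he', Set.image_compl_eq π.bijective, Set.image_compl_eq π'.bijective]
  simp [hp]

theorem eq_of_embedding_self {n : ℕ} {π π' : Equiv.Perm (Fin n)} {ρ : FinPerm}
    (e : Embedding ρ ⟨n, π⟩) (e' : Embedding ρ ⟨n, π'⟩)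
    (he : Set.range e.toFun = Set.univ) (he' : Set.range e'.toFun = Set.univ) : π = π' := by
  ext1 i
  refine eq_of_range_eq e e' (he.trans he'.symm) ?_ (by simp [he])
  rw [he, he', Set.image_univ, Set.image_univ, π.range_eq_univ, π'.range_eq_univ]

end Patterns

/-! ### Counting codes -/

section Counting

/-- A set of permutations closed under taking patterns. -/
def IsClass (C : Set FinPerm) : Prop :=
  ∀ ρ π : FinPerm, Embedding ρ π → π ∈ C → ρ ∈ C

/-- `π` can be reconstructed from the tag `t`, the numbers `k` and the patterns `ρ` and `τ`. -/
def IsCode {n : ℕ} (π : Equiv.Perm (Fin n)) (t : ℕ) (k : Fin 12 → ℕ) (ρ τ : FinPerm) : Prop :=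
  (t = 0 ∧ ∃ e : Embedding ρ ⟨n, π⟩, Set.range e.toFun = Set.univ) ∨
  (t = 1 ∧ ∃ (p : Fin n) (e : Embedding ρ ⟨n, π⟩), Set.range e.toFun = {p}ᶜ ∧
    k 0 = p ∧ k 1 = π p) ∨
  (t = 2 ∧ ∃ (p q : Fin n) (e : Embedding ρ ⟨n, π⟩) (g : Embedding τ ⟨n, π⟩),
    CutAt π p q e.toFun g.toFun ∧ k = cutKey π p q e.toFun g.toFun)

theorem IsCode.eq {n : ℕ} {π π' : Equiv.Perm (Fin n)} {t : ℕ} {k : Fin 12 → ℕ} {ρ τ : FinPerm}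
    (h : IsCode π t k ρ τ) (h' : IsCode π' t k ρ τ) : π = π' := by
  rcases h with ⟨rfl, e, he⟩ | ⟨rfl, p, e, he, h0, h1⟩ | ⟨rfl, p, q, e, g, hc, hk⟩
  · obtain ⟨-, e', he'⟩ := h'.resolve_right (by simp)
    exact eq_of_embedding_self e e' he he'
  · obtain ⟨-, p', e', he', h0', h1'⟩ := (h'.resolve_left (by simp)).resolve_right (by simp)
    have hp : p = p' := Fin.ext (h0.symm.trans h0')
    subst hp
    exact eq_of_embedding_compl_singleton (Fin.ext (h1.symm.trans h1')) e e' he he'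
  · obtain ⟨-, p', q', e', g', hc', hk'⟩ := (h'.resolve_left (by simp)).resolve_left (by simp)
    exact hc.eq_of_cutKey_eq hc' (hk.symm.trans hk')

/-- The elements of length `n` of a set of permutations. -/
noncomputable def slice (C : Set FinPerm) (n : ℕ) : Finset FinPerm :=
  (Set.toFinite {π : Equiv.Perm (Fin n) | (⟨n, π⟩ : FinPerm) ∈ C}).toFinset.map
    (Function.Embedding.sigmaMk n)

theorem card_slice (C : Set FinPerm) (n : ℕ) : (slice C n).card = count C n := by
  rw [slice, Finset.card_map, count, Set.ncard_eq_toFinset_card _ (Set.toFinite _)]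

theorem mem_slice {C : Set FinPerm} {π : FinPerm} (h : π ∈ C) : π ∈ slice C π.1 := by
  simp only [slice, Finset.mem_map, Set.Finite.mem_toFinset]
  exact ⟨π.2, h, rfl⟩

theorem count_le_of_isCode {C D : Set FinPerm} {n : ℕ}
    (h : ∀ π : Equiv.Perm (Fin n), (⟨n, π⟩ : FinPerm) ∈ D → ∃ t k ρ τ, IsCode π t k ρ τ ∧
      t < 3 ∧ (∀ i, k i ≤ n) ∧ ρ ∈ C ∧ τ ∈ C ∧ ρ.1 + τ.1 ≤ n) :
    count D n ≤ 3 * ((n + 1) ^ 12 *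
      ∑ x ∈ (Finset.range (n + 1) ×ˢ Finset.range (n + 1)) with x.1 + x.2 ≤ n,
        count C x.1 * count C x.2) := by
  classical
  choose! t k ρ τ hcode ht hk hρ hτ hsum using h
  let F : Equiv.Perm (Fin n) → ℕ × (Fin 12 → ℕ) × FinPerm × FinPerm :=
    fun π => (t π, k π, ρ π, τ π)
  let W : Finset (FinPerm × FinPerm) :=
    ((Finset.range (n + 1) ×ˢ Finset.range (n + 1)).filter fun x => x.1 + x.2 ≤ n).biUnion
      fun x => slice C x.1 ×ˢ slice C x.2
  let T : Finset (ℕ × (Fin 12 → ℕ) × FinPerm × FinPerm) :=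
    Finset.range 3 ×ˢ (Fintype.piFinset fun _ => Finset.range (n + 1)) ×ˢ W
  have hmaps : ∀ π ∈ {π : Equiv.Perm (Fin n) | (⟨n, π⟩ : FinPerm) ∈ D}, F π ∈ (T : Set _) := by
    intro π hπ
    have h1 := hsum π hπ
    simp only [T, F, W, Finset.mem_coe, Finset.mem_product, Finset.mem_range,
      Fintype.mem_piFinset, Finset.mem_biUnion, Finset.mem_filter]
    refine ⟨ht π hπ, fun i => Nat.lt_succ_of_le (hk π hπ i), ((ρ π).1, (τ π).1),
      ⟨⟨by simp only; omega, by simp only; omega⟩, h1⟩, mem_slice (hρ π hπ), mem_slice (hτ π hπ)⟩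
  have hinj : Set.InjOn F {π : Equiv.Perm (Fin n) | (⟨n, π⟩ : FinPerm) ∈ D} := by
    intro π hπ π' hπ' heq
    simp only [F, Prod.mk.injEq] at heq
    obtain ⟨h1, h2, h3, h4⟩ := heq
    have := hcode π hπ
    rw [h1, h2, h3, h4] at this
    exact this.eq (hcode π' hπ')
  calc count D n ≤ (T : Set _).ncard := Set.ncard_le_ncard_of_injOn F hmaps hinj T.finite_toSet
    _ = 3 * ((n + 1) ^ 12 * W.card) := by
        rw [Set.ncard_coe_finset]
        simp [T, Finset.card_product, Fintype.card_piFinset]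
    _ ≤ _ := by
        refine Nat.mul_le_mul_left _ (Nat.mul_le_mul_left _ ?_)
        refine Finset.card_biUnion_le.trans (le_of_eq (Finset.sum_congr rfl fun x _ => ?_))
        rw [Finset.card_product, card_slice, card_slice]

end Counting

/-! ### From codes to growth rates -/

section Growth

/-- An infinite class has arbitrarily long elements; the first `n` positions of one of length at
least `n` give a pattern of length `n`. -/
theorem count_pos {C : Set FinPerm} (hC : IsClass C) (hinf : C.Infinite) (n : ℕ) :
    0 < count C n := by
  have hex : ∃ π ∈ C, n ≤ π.1 := by
    by_contra! hlt
    refine hinf (Set.Finite.subset (s := ⋃ m ∈ Finset.range n, (slice C m : Set FinPerm))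
      (Set.Finite.biUnion (Finset.finite_toSet _) fun m _ => Finset.finite_toSet _) ?_)
    intro π hπ
    simp only [Set.mem_iUnion]
    exact ⟨π.1, Finset.mem_range.2 (hlt π hπ), mem_slice hπ⟩
  obtain ⟨π, hπ, hn⟩ := hex
  obtain ⟨ρ, e, -, hρ⟩ := exists_embedding_range_eq π (Set.range (Fin.castLE hn))
  rw [← Set.image_univ, Set.ncard_image_of_injective _ (Fin.castLE_injective hn),
    Set.ncard_univ, Nat.card_eq_fintype_card, Fintype.card_fin] at hρ
  obtain ⟨m, ρ⟩ := ρ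
  subst hρ
  exact (Set.ncard_pos (Set.toFinite _)).2 ⟨ρ, hC _ _ e hπ⟩

theorem one_le_growthRate {C : Set FinPerm} (hC : IsClass C) (hinf : C.Infinite) :
    1 ≤ growthRate C := by
  refine Filter.le_limsup_of_le (f := Filter.atTop) (by isBoundedDefault) fun b hb => ?_
  obtain ⟨n, hn⟩ := hb.exists
  refine le_trans ?_ hn
  have h1 : (1 : ENNReal) ≤ count C n := by exact_mod_cast count_pos hC hinf n
  simpa using ENNReal.rpow_le_rpow h1 (show (0 : ℝ) ≤ 1 / n by positivity)

theorem growthRate_mono {C D : Set FinPerm} (h : C ⊆ D) : growthRate C ≤ growthRate D := by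
  refine Filter.limsup_le_limsup (Filter.Eventually.of_forall fun n => ?_)
  refine ENNReal.rpow_le_rpow ?_ (by positivity)
  have h1 : count C n ≤ count D n := Set.ncard_le_ncard (fun π hπ => h hπ) (Set.toFinite _)
  exact_mod_cast h1

open NNReal in
theorem exists_count_le {C : Set FinPerm} {r : ℝ≥0} (hr1 : 1 ≤ r) (hr : growthRate C < r) :
    ∃ K : ℕ, ∀ n, (count C n : ℝ≥0) ≤ K * r ^ n := by
  have h := Filter.eventually_lt_of_limsup_lt hr
  obtain ⟨N, hN⟩ := Filter.eventually_atTop.1 h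
  -- The sum takes care of the lengths up to `N`. The summand 1 serves the larger ones, which are
  -- positive, so that the `n`-th root can be undone.
  refine ⟨1 + ∑ n ∈ Finset.range (N + 1), count C n, fun n => ?_⟩
  rcases lt_or_ge n (N + 1) with hn | hn
  · have h1 : count C n ≤ 1 + ∑ n ∈ Finset.range (N + 1), count C n :=
      le_add_left (Finset.single_le_sum (f := fun n => count C n) (fun _ _ => Nat.zero_le _)
        (Finset.mem_range.2 hn))
    calc (count C n : ℝ≥0) ≤ ((1 + ∑ n ∈ Finset.range (N + 1), count C n : ℕ) : ℝ≥0) * 1 := by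
          rw [mul_one]
          exact_mod_cast h1
      _ ≤ _ := by gcongr; exact one_le_pow₀ hr1
  · have hn0 : (n : ℝ) ≠ 0 := by
      have : 0 < n := by omega
      positivity
    have h2 := hN n (by omega)
    have h3 : (count C n : ENNReal) ≤ (r : ENNReal) ^ n := by
      have := ENNReal.rpow_le_rpow h2.le (Nat.cast_nonneg n)
      rwa [← ENNReal.rpow_mul, one_div, inv_mul_cancel₀ hn0, ENNReal.rpow_one,
        ENNReal.rpow_natCast] at this
    have h4 : (count C n : ℝ≥0) ≤ r ^ n := by exact_mod_cast h3
    refine h4.trans (le_mul_of_one_le_left' ?_)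
    push_cast
    exact le_self_add

open NNReal in
theorem growthRate_le_of_count_le {D : Set FinPerm} {K d : ℕ} {r s : ℝ≥0} (hr : 1 ≤ r)
    (hrs : r < s) (h : ∀ n, (count D n : ℝ≥0) ≤ K * (n + 1) ^ d * r ^ n) : growthRate D ≤ s := by
  have hr0 : (0 : ℝ) < r := lt_of_lt_of_le one_pos (by exact_mod_cast hr)
  have h1 : 1 < (s : ℝ) / r := (one_lt_div hr0).2 (by exact_mod_cast hrs)
  -- The shift by one produces the polynomial `(n + 1) ^ d`; it costs a factor `s / r`, absorbed in
  -- the constant on the next line.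
  have ht := (tendsto_pow_const_div_const_pow_of_one_lt d h1).comp (Filter.tendsto_add_atTop_nat 1)
  have ht2 := ht.const_mul (K * ((s : ℝ) / r))
  rw [mul_zero] at ht2
  have hev := ht2.eventually (gt_mem_nhds one_pos)
  refine Filter.limsup_le_of_le (by isBoundedDefault) ?_
  filter_upwards [hev, Filter.eventually_gt_atTop 0] with n hn hn0
  have hs0 : (0 : ℝ) < s := hr0.trans (by exact_mod_cast hrs)
  have h2 : (K : ℝ) * (n + 1) ^ d * r ^ n ≤ s ^ n := by
    simp only [Function.comp, Nat.cast_add, Nat.cast_one] at hn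
    have h3 : K * ((s : ℝ) / r) * ((n + 1) ^ d / (s / r) ^ (n + 1)) =
        K * (n + 1) ^ d * r ^ n / s ^ n := by
      rw [div_pow, pow_succ (s : ℝ), pow_succ (r : ℝ)]
      field_simp
    rw [h3, div_lt_one (by positivity)] at hn
    exact hn.le
  have h4 : (count D n : ℝ≥0) ≤ s ^ n := (h n).trans (by exact_mod_cast h2)
  have h5 : (count D n : ENNReal) ≤ (s : ENNReal) ^ n := by exact_mod_cast h4
  have h6 := ENNReal.rpow_le_rpow h5 (show (0 : ℝ) ≤ 1 / n by positivity)
  rwa [← ENNReal.rpow_natCast, ← ENNReal.rpow_mul, mul_one_div_cancel (by positivity),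
    ENNReal.rpow_one] at h6

open NNReal in
theorem growthRate_le_of_isCode {C D : Set FinPerm} (hC : IsClass C) (hinf : C.Infinite)
    (h : ∀ n, ∀ π : Equiv.Perm (Fin n), (⟨n, π⟩ : FinPerm) ∈ D → ∃ t k ρ τ, IsCode π t k ρ τ ∧
      t < 3 ∧ (∀ i, k i ≤ n) ∧ ρ ∈ C ∧ τ ∈ C ∧ ρ.1 + τ.1 ≤ n) :
    growthRate D ≤ growthRate C := by
  refine le_of_forall_gt fun u hu => ?_
  obtain ⟨s, hs, hsu⟩ := ENNReal.lt_iff_exists_nnreal_btwn.1 hu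
  obtain ⟨r, hr, hrs⟩ := ENNReal.lt_iff_exists_nnreal_btwn.1 hs
  have hr1 : 1 ≤ r := by exact_mod_cast (one_le_growthRate hC hinf).trans hr.le
  obtain ⟨K, hK⟩ := exists_count_le hr1 hr
  -- Three tags and two factors `K`; the exponent is 12 for the entries of the key plus 2 for the
  -- pair of lengths.
  refine lt_of_le_of_lt (growthRate_le_of_count_le (K := 3 * K ^ 2) (d := 14) hr1
    (by exact_mod_cast hrs) fun n => ?_) hsu
  have hcount : (count D n : ℝ≥0) ≤ _ := Nat.cast_le.2 (count_le_of_isCode (h n))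
  refine hcount.trans ?_
  push_cast
  have hsum : ∑ x ∈ (Finset.range (n + 1) ×ˢ Finset.range (n + 1)) with x.1 + x.2 ≤ n,
      (count C x.1 : ℝ≥0) * count C x.2 ≤ (n + 1) ^ 2 * (K ^ 2 * r ^ n) := by
    calc _ ≤ ∑ x ∈ (Finset.range (n + 1) ×ˢ Finset.range (n + 1)) with x.1 + x.2 ≤ n,
          K ^ 2 * r ^ n := by
          refine Finset.sum_le_sum fun x hx => ?_
          have hx' := (Finset.mem_filter.1 hx).2
          calc (count C x.1 : ℝ≥0) * count C x.2 ≤ (K * r ^ x.1) * (K * r ^ x.2) := by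
                gcongr <;> exact hK _
            _ = K ^ 2 * r ^ (x.1 + x.2) := by ring
            _ ≤ K ^ 2 * r ^ n := by gcongr
      _ ≤ ∑ x ∈ Finset.range (n + 1) ×ˢ Finset.range (n + 1), K ^ 2 * r ^ n :=
          Finset.sum_le_sum_of_subset (Finset.filter_subset _ _)
      _ = (n + 1) ^ 2 * (K ^ 2 * r ^ n) := by
          simp [sq]
  calc (3 : ℝ≥0) * ((n + 1) ^ 12 * _) ≤ 3 * ((n + 1) ^ 12 * ((n + 1) ^ 2 * (K ^ 2 * r ^ n))) := by
        gcongr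
    _ = 3 * K ^ 2 * (n + 1) ^ 14 * r ^ n := by ring

/-- One element of `π` can be deleted to reach `C`, or `π` has an inversion such that the patterns
avoiding the positions in its range, and those avoiding the values in its range, are in `C`. -/
def HasCut (C : Set FinPerm) (π : FinPerm) : Prop :=
  (∃ p, ∀ ρ (e : Embedding ρ π), (∀ i, e.toFun i ≠ p) → ρ ∈ C) ∨
    ∃ p q, p < q ∧ π.2 q < π.2 p ∧
      (∀ ρ (e : Embedding ρ π), (∀ i, e.toFun i < p ∨ q < e.toFun i) → ρ ∈ C) ∧
      ∀ ρ (e : Embedding ρ π), (∀ i, π.2 (e.toFun i) < π.2 q ∨ π.2 p < π.2 (e.toFun i)) → ρ ∈ C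

theorem growthRate_le_of_hasCut {C D : Set FinPerm} (hC : IsClass C) (hinf : C.Infinite)
    (h : ∀ π ∈ D, No321 π.2 ∧ (π ∈ C ∨ HasCut C π)) :
    growthRate D ≤ growthRate C := by
  refine growthRate_le_of_isCode hC hinf fun n π hπ => ?_
  -- The empty permutation fills the place of the second pattern when only one is needed.
  have hempty : (⟨0, 1⟩ : FinPerm) ∈ C := by
    obtain ⟨σ, hσ⟩ := hinf.nonempty
    exact hC _ _ ⟨fun i => i.elim0, fun i => i.elim0, fun i => i.elim0⟩ hσ
  obtain ⟨h321, hself | ⟨p, hp⟩ | ⟨p, q, hpq, hv, h1, h2⟩⟩ := h _ hπ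
  · obtain ⟨ρ, e, he, hρ⟩ := exists_embedding_range_eq ⟨n, π⟩ Set.univ
    refine ⟨0, 0, ρ, ⟨0, 1⟩, Or.inl ⟨rfl, e, he⟩, by norm_num, by simp, hC _ _ e hself, hempty, ?_⟩
    simp [hρ, Set.ncard_univ]
  · obtain ⟨ρ, e, he, hρ⟩ := exists_embedding_range_eq ⟨n, π⟩ {p}ᶜ
    refine ⟨1, fun i => if i = 0 then p else π p, ρ, ⟨0, 1⟩,
      Or.inr (Or.inl ⟨rfl, p, e, he, by simp, by simp⟩), by norm_num, ?_, hp ρ e ?_, hempty, ?_⟩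
    · intro i
      dsimp only
      split_ifs <;> exact Fin.is_le'
    · intro i hi
      have : e.toFun i ∈ Set.range e.toFun := ⟨i, rfl⟩
      rw [he] at this
      exact this hi
    · have := Set.ncard_le_card ({p}ᶜ : Set (Fin n))
      rw [Nat.card_eq_fintype_card, Fintype.card_fin] at this
      simpa [hρ] using this
  · obtain ⟨ρ, τ, e, g, hcut, hsum⟩ := exists_cutAt h321 hpq hv
    exact ⟨2, _, ρ, τ, Or.inr (Or.inr ⟨rfl, p, q, e, g, hcut, rfl⟩), by norm_num,
      cutKey_le π p q _ _ ((Nat.le_add_right _ _).trans hsum) ((Nat.le_add_left _ _).trans hsum), h2 ρ e hcut.not_between_val,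
      h1 τ g hcut.not_between_pos, hsum⟩

end Growth

/-! ### Embeddings of direct sums -/

section DirectSum

theorem no321_of_mem_av {π : FinPerm} (h : π ∈ Av {decreasing 3}) : No321 π.2 := by
  intro i j k hij hjk h1 h2
  have hpos : StrictMono (![i, j, k] : Fin 3 → Fin π.1) :=
    Fin.strictMono_iff_lt_succ.2 (Fin.forall_fin_two.2 ⟨hij, hjk⟩)
  have hval : StrictAnti fun a => π.2 ((![i, j, k] : Fin 3 → Fin π.1) a) :=
    Fin.strictAnti_iff_succ_lt.2 (Fin.forall_fin_two.2 ⟨h1, h2⟩)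
  exact h _ rfl ⟨⟨![i, j, k], fun a b => hpos.lt_iff_lt,
    fun a b => hval.lt_iff_gt.trans Fin.rev_lt_rev.symm⟩⟩

theorem isClass_av (B : Set FinPerm) : IsClass (Av B) := by
  rintro ρ π e hπ σ hσ ⟨f⟩
  exact hπ σ hσ ⟨f.trans e⟩

theorem IsClass.inter {C D : Set FinPerm} (hC : IsClass C) (hD : IsClass D) : IsClass (C ∩ D) :=
  fun ρ π e hπ => ⟨hC ρ π e hπ.1, hD ρ π e hπ.2⟩

theorem directSum_apply_castAdd (α β : FinPerm) (i : Fin α.1) :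
    (directSum α β).2 (Fin.castAdd β.1 i) = Fin.castAdd β.1 (α.2 i) := by
  change finSumFinEquiv (Equiv.sumCongr α.2 β.2 (finSumFinEquiv.symm (Fin.castAdd β.1 i))) = _
  rw [finSumFinEquiv_symm_apply_castAdd]
  rfl

theorem directSum_apply_natAdd (α β : FinPerm) (i : Fin β.1) :
    (directSum α β).2 (Fin.natAdd α.1 i) = Fin.natAdd α.1 (β.2 i) := by
  change finSumFinEquiv (Equiv.sumCongr α.2 β.2 (finSumFinEquiv.symm (Fin.natAdd α.1 i))) = _
  rw [finSumFinEquiv_symm_apply_natAdd]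
  rfl

/-- The first summand embeds in a direct sum. -/
def embeddingLeft (α β : FinPerm) : Embedding α (directSum α β) where
  toFun := Fin.castAdd β.1
  position_lt_iff := fun _ _ => Iff.rfl
  value_lt_iff := fun i j => by
    rw [directSum_apply_castAdd, directSum_apply_castAdd]
    rfl

/-- The second summand embeds in a direct sum. -/
def embeddingRight (α β : FinPerm) : Embedding β (directSum α β) where
  toFun := Fin.natAdd α.1
  position_lt_iff := fun _ _ => Nat.add_lt_add_iff_left
  value_lt_iff := fun i j => by
    rw [directSum_apply_natAdd, directSum_apply_natAdd]
    exact Nat.add_lt_add_iff_left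

/-- `x` lies below and to the left of `y` in `π`. -/
def Below (π : FinPerm) (x y : Fin π.1) : Prop := x < y ∧ π.2 x < π.2 y

theorem Below.trans {π : FinPerm} {x y z : Fin π.1} (h : Below π x y) (h' : Below π y z) :
    Below π x z := ⟨h.1.trans h'.1, h.2.trans h'.2⟩

theorem Embedding.below_iff {σ π : FinPerm} (e : Embedding σ π) {x y : Fin σ.1} :
    Below π (e.toFun x) (e.toFun y) ↔ Below σ x y :=
  and_congr (e.position_lt_iff x y) (e.value_lt_iff x y)

theorem below_directSum (α β : FinPerm) (i : Fin α.1) (j : Fin β.1) :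
    Below (directSum α β) ((embeddingLeft α β).toFun i) ((embeddingRight α β).toFun j) := by
  have h : ∀ (x : Fin α.1) (y : Fin β.1), Fin.castAdd β.1 x < Fin.natAdd α.1 y := fun x y => by
    simp only [Fin.lt_def, Fin.val_castAdd, Fin.val_natAdd]
    omega
  refine ⟨h i j, ?_⟩
  rw [embeddingLeft, embeddingRight, directSum_apply_castAdd, directSum_apply_natAdd]
  exact h _ _

/-- Embeddings of two summands, one below the other, combine. -/
def Embedding.directSum {α β π : FinPerm} (f : Embedding α π) (g : Embedding β π)
    (h : ∀ i j, Below π (f.toFun i) (g.toFun j)) : Embedding (directSum α β) π where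
  toFun := Fin.addCases (m := α.1) (n := β.1) f.toFun g.toFun
  position_lt_iff := fun i j => by
    induction i using Fin.addCases (m := α.1) (n := β.1) with
    | left i =>
      induction j using Fin.addCases (m := α.1) (n := β.1) with
      | left j =>
        simp only [Fin.addCases_left]
        exact f.position_lt_iff i j
      | right j =>
        simp only [Fin.addCases_left, Fin.addCases_right]
        exact iff_of_true (h i j).1 (below_directSum α β i j).1
    | right i =>
      induction j using Fin.addCases (m := α.1) (n := β.1) with
      | left j =>
        simp only [Fin.addCases_left, Fin.addCases_right]
        exact iff_of_false (h j i).1.not_gt (below_directSum α β j i).1.not_gt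
      | right j =>
        simp only [Fin.addCases_right]
        exact (g.position_lt_iff i j).trans ((embeddingRight α β).position_lt_iff i j).symm
  value_lt_iff := fun i j => by
    induction i using Fin.addCases (m := α.1) (n := β.1) with
    | left i =>
      induction j using Fin.addCases (m := α.1) (n := β.1) with
      | left j =>
        simp only [Fin.addCases_left]
        exact (f.value_lt_iff i j).trans ((embeddingLeft α β).value_lt_iff i j).symm
      | right j =>
        simp only [Fin.addCases_left, Fin.addCases_right]
        exact iff_of_true (h i j).2 (below_directSum α β i j).2
    | right i =>
      induction j using Fin.addCases (m := α.1) (n := β.1) with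
      | left j =>
        simp only [Fin.addCases_left, Fin.addCases_right]
        exact iff_of_false (h j i).2.not_gt (below_directSum α β j i).2.not_gt
      | right j =>
        simp only [Fin.addCases_right]
        exact (g.value_lt_iff i j).trans ((embeddingRight α β).value_lt_iff i j).symm

theorem Involves.exists_below {α β π : FinPerm} (h : Involves π (directSum α β)) :
    ∃ (f : Embedding α π) (g : Embedding β π), ∀ i j, Below π (f.toFun i) (g.toFun j) := by
  obtain ⟨e⟩ := h
  exact ⟨(embeddingLeft α β).trans e, (embeddingRight α β).trans e,
    fun i j => e.below_iff.2 (below_directSum α β i j)⟩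

/-- The embedding of the permutation of length one at a given position. -/
def embeddingSingle {π : FinPerm} (x : Fin π.1) : Embedding single π where
  toFun := fun _ => x
  position_lt_iff := fun i j => by
    rw [Subsingleton.elim (α := Fin 1) i j]
    exact iff_of_false (lt_irrefl _) (lt_irrefl _)
  value_lt_iff := fun i j => by
    rw [Subsingleton.elim (α := Fin 1) i j]
    exact iff_of_false (lt_irrefl _) (lt_irrefl _)

theorem involves_directSum_single {α β π : FinPerm} (f : Embedding α π) (x : Fin π.1)
    (g : Embedding β π) (hf : ∀ i, Below π (f.toFun i) x) (hg : ∀ j, Below π x (g.toFun j)) :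
    Involves π (directSum α (directSum single β)) := by
  refine ⟨f.directSum ((embeddingSingle x).directSum g fun _ => hg) fun i j => ?_⟩
  induction j using Fin.addCases (m := single.1) (n := β.1) with
  | left j =>
    simp only [Embedding.directSum, Fin.addCases_left]
    exact hf i
  | right j =>
    simp only [Embedding.directSum, Fin.addCases_right]
    exact (hf i).trans (hg j)

end DirectSum

/-! ### The least copy of a 2-rigid permutation -/

section LeastEmbedding

theorem IsRigid.exists_inversion {α : FinPerm} (h : IsRigid 2 α) (x : Fin α.1) :
    ∃ y, (x < y ∧ α.2 y < α.2 x) ∨ (y < x ∧ α.2 x < α.2 y) := by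
  obtain ⟨f, i, rfl⟩ := h.2 x
  have h1 : ∀ a b : Fin 2, a < b → f.toFun a < f.toFun b ∧ α.2 (f.toFun b) < α.2 (f.toFun a) :=
    fun a b hab => ⟨(f.position_lt_iff a b).2 hab, (f.value_lt_iff b a).2 (Fin.rev_lt_rev.2 hab)⟩
  have h01 : (0 : Fin 2) < 1 := by decide
  rcases (show i = (0 : Fin 2) ∨ i = (1 : Fin 2) from Fin.exists_fin_two.1 ⟨i, rfl⟩) with hi | hi
  · rw [hi]
    exact ⟨_, Or.inl (h1 0 1 h01)⟩
  · rw [hi]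
    exact ⟨_, Or.inr (h1 0 1 h01)⟩

variable {α π : FinPerm}

/-- If the images of `x` formed an inversion, the partner of `x` in an inversion of `α` would
complete a 321: its image under `g` if it is right of `x`, under `f` if it is left. -/
theorem value_lt_of_position_lt (hα : IsRigid 2 α) (hπ : No321 π.2) (f g : Embedding α π)
    {x : Fin α.1} (h : f.toFun x < g.toFun x) : π.2 (f.toFun x) < π.2 (g.toFun x) := by
  by_contra hv
  have hv' : π.2 (g.toFun x) < π.2 (f.toFun x) :=
    lt_of_le_of_ne (le_of_not_gt hv) fun he => h.ne' (π.2.injective he)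
  obtain ⟨y, ⟨h1, h2⟩ | ⟨h1, h2⟩⟩ := hα.exists_inversion x
  · exact hπ _ _ _ h ((g.position_lt_iff x y).2 h1) hv' ((g.value_lt_iff y x).2 h2)
  · exact hπ _ _ _ ((f.position_lt_iff y x).2 h1) h ((f.value_lt_iff x y).2 h2) hv'

theorem exists_inf_embedding (hα : IsRigid 2 α) (hπ : No321 π.2) (f g : Embedding α π) :
    ∃ m : Embedding α π, ∀ x, m.toFun x = min (f.toFun x) (g.toFun x) ∧
      π.2 (m.toFun x) = min (π.2 (f.toFun x)) (π.2 (g.toFun x)) := by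
  have hval : ∀ x, π.2 (min (f.toFun x) (g.toFun x)) =
      min (π.2 (f.toFun x)) (π.2 (g.toFun x)) := fun x => by
    rcases lt_trichotomy (f.toFun x) (g.toFun x) with h | h | h
    · rw [min_eq_left h.le, min_eq_left (value_lt_of_position_lt hα hπ f g h).le]
    · simp [h]
    · rw [min_eq_right h.le, min_eq_right (value_lt_of_position_lt hα hπ g f h).le]
  have key : ∀ {β γ : Type} [LinearOrder β] [LinearOrder γ] {a b : Fin α.1 → β}
      {c : Fin α.1 → γ}, (∀ i j, a i < a j ↔ c i < c j) → (∀ i j, b i < b j ↔ c i < c j) →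
      Function.Injective c → ∀ i j, min (a i) (b i) < min (a j) (b j) ↔ c i < c j := by
    intro β γ _ _ a b c ha hb hc i j
    rcases lt_trichotomy (c i) (c j) with h | h | h
    · exact iff_of_true (min_lt_min ((ha i j).2 h) ((hb i j).2 h)) h
    · simp [hc h]
    · exact iff_of_false (min_lt_min ((ha j i).2 h) ((hb j i).2 h)).not_gt h.not_gt
  refine ⟨⟨fun x => min (f.toFun x) (g.toFun x),
    key (c := id) f.position_lt_iff g.position_lt_iff Function.injective_id, fun i j => ?_⟩,
    fun x => ⟨rfl, hval x⟩⟩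
  rw [hval, hval]
  exact key f.value_lt_iff g.value_lt_iff α.2.injective i j

theorem exists_least_embedding (hα : IsRigid 2 α) (hπ : No321 π.2) (f₀ : Embedding α π) :
    ∃ h : Embedding α π, ∀ (f : Embedding α π) (x : Fin α.1),
      h.toFun x ≤ f.toFun x ∧ π.2 (h.toFun x) ≤ π.2 (f.toFun x) := by
  -- A copy of least total position is least pointwise: its minimum with any other copy cannot have
  -- smaller weight, so it is the copy itself.
  let weight : Embedding α π → ℕ := fun f => ∑ x, (f.toFun x : ℕ)
  obtain ⟨h, -, hmin⟩ := (measure weight).wf.has_min Set.univ ⟨f₀, trivial⟩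
  refine ⟨h, fun f x => ?_⟩
  obtain ⟨m, hm⟩ := exists_inf_embedding hα hπ h f
  have hle : ∀ x ∈ Finset.univ, (m.toFun x : ℕ) ≤ h.toFun x := fun x _ => by
    have : m.toFun x ≤ h.toFun x := (hm x).1.le.trans (min_le_left _ _)
    exact this
  have heq : m.toFun x = h.toFun x := by
    have hsum : weight m = weight h :=
      le_antisymm (Finset.sum_le_sum hle) (not_lt.1 (hmin m trivial))
    exact Fin.ext ((Finset.sum_eq_sum_iff_of_le hle).1 hsum x (Finset.mem_univ x))
  have h1 := (hm x).1
  have h2 := (hm x).2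
  rw [heq] at h1 h2
  exact ⟨h1.le.trans (min_le_right _ _), h2.le.trans (min_le_right _ _)⟩

end LeastEmbedding

/-! ### Cutting a permutation that involves `α ⊕ β` -/

section Cut

variable {C : Set FinPerm} {α β π : FinPerm}

/-- With `β` empty nothing lies above and to the right of a copy of `α`, so the cut is taken at the
greatest and the last element instead: a pattern lying wholly below and to the left of one of them
avoids `α`. -/
theorem hasCut_of_isEmpty (hβ : β.1 = 0) (hπ : ¬ Involves π (directSum α (directSum single β)))
    (hC : ∀ ρ, Embedding ρ π → ¬ Involves ρ (directSum α β) → ρ ∈ C) (x : Fin π.1) :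
    HasCut C π := by
  have : Nonempty (Fin π.1) := ⟨x⟩
  have : IsEmpty (Fin β.1) := by rw [hβ]; infer_instance
  have key : ∀ ρ (e : Embedding ρ π) (y : Fin π.1), (∀ i, Below π (e.toFun i) y) → ρ ∈ C := by
    intro ρ e y hy
    refine hC ρ e fun h => hπ ?_
    obtain ⟨f, -, -⟩ := h.exists_below
    exact involves_directSum_single (f.trans e) y ⟨isEmptyElim, isEmptyElim, isEmptyElim⟩
      (fun i => hy (f.toFun i)) isEmptyElim
  obtain ⟨q, hq⟩ := Finite.exists_max (id : Fin π.1 → Fin π.1)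
  obtain ⟨p, hp⟩ := Finite.exists_max π.2
  have lt_q : ∀ {i}, i ≠ q → i < q := fun hi => lt_of_le_of_ne (hq _) hi
  have lt_p : ∀ {i}, i ≠ p → π.2 i < π.2 p := fun hi =>
    lt_of_le_of_ne (hp _) fun h => hi (π.2.injective h)
  by_cases hpq : p = q
  · subst hpq
    exact Or.inl ⟨p, fun ρ e he => key ρ e p fun i => ⟨lt_q (he i), lt_p (he i)⟩⟩
  · refine Or.inr ⟨p, q, lt_q hpq, lt_p (Ne.symm hpq), fun ρ e he => key ρ e p fun i => ?_,
      fun ρ e he => key ρ e q fun i => ?_⟩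
    · have h1 := (he i).resolve_right (not_lt.2 (hq _))
      exact ⟨h1, lt_p h1.ne⟩
    · have h1 := (he i).resolve_right (not_lt.2 (hp _))
      exact ⟨lt_q fun h => h1.ne (congrArg π.2 h), h1⟩

theorem hasCut_of_involves (hα : IsRigid 2 α) (h321 : No321 π.2) (x : Fin β.1)
    (hπ : ¬ Involves π (directSum α (directSum single β)))
    (hinv : Involves π (directSum α β))
    (hC : ∀ ρ, Embedding ρ π → ¬ Involves ρ (directSum α β) → ρ ∈ C) :
    HasCut C π := by
  obtain ⟨f₀, g₀, hfg₀⟩ := hinv.exists_below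
  obtain ⟨h, hh⟩ := exists_least_embedding hα h321 f₀
  let Q : Set (Fin π.1) := {y | ∀ i, Below π (h.toFun i) y}
  have mem_Q : ∀ {f : Embedding α π} {y}, (∀ i, Below π (f.toFun i) y) → y ∈ Q := fun hf i =>
    ⟨(hh _ i).1.trans_lt (hf i).1, (hh _ i).2.trans_lt (hf i).2⟩
  -- The exchange argument: in a copy of `α ⊕ β` inside `ρ`, the `β` lies in `Q` and so beyond `y`,
  -- while `h` can replace the `α`; then `h`, `y` and the `β` give `α ⊕ 1 ⊕ β`.
  have key : ∀ ρ (e : Embedding ρ π), ∀ y ∈ Q, (∀ i, e.toFun i ∈ Q → Below π y (e.toFun i)) →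
      ρ ∈ C := by
    intro ρ e y hyQ hy
    refine hC ρ e fun hρ => hπ ?_
    obtain ⟨f, g, hfg⟩ := hρ.exists_below
    exact involves_directSum_single h y (g.trans e) hyQ fun j =>
      hy (g.toFun j) (mem_Q (f := f.trans e) fun i => e.below_iff.2 (hfg i j))
  have hne : Q.Nonempty := ⟨g₀.toFun x, mem_Q fun i => hfg₀ i x⟩
  obtain ⟨p, hpQ, hp⟩ := Set.exists_min_image Q id Q.toFinite hne
  obtain ⟨q, hqQ, hq⟩ := Set.exists_min_image Q π.2 Q.toFinite hne
  have lt_p : ∀ {i}, i ∈ Q → i ≠ p → p < i := fun hi hip => lt_of_le_of_ne (hp _ hi) hip.symm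
  have lt_q : ∀ {i}, i ∈ Q → i ≠ q → π.2 q < π.2 i := fun hi hiq =>
    lt_of_le_of_ne (hq _ hi) fun h => hiq (π.2.injective h).symm
  by_cases hpq : p = q
  · subst hpq
    exact Or.inl ⟨p, fun ρ e he => key ρ e p hpQ fun i hi => ⟨lt_p hi (he i), lt_q hi (he i)⟩⟩
  · refine Or.inr ⟨p, q, lt_p hqQ (Ne.symm hpq), lt_q hpQ hpq,
      fun ρ e he => key ρ e q hqQ fun i hi => ?_, fun ρ e he => key ρ e p hpQ fun i hi => ?_⟩
    -- No element of `Q` is left of `p`, so those that avoid the range of positions are right of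
    -- `q`, and above it because `q` is lowest in `Q`.
    · have h1 := (he i).resolve_left (not_lt.2 (hp _ hi))
      exact ⟨h1, lt_q hi h1.ne'⟩
    · have h1 := (he i).resolve_left (not_lt.2 (hq _ hi))
      exact ⟨lt_p hi fun h => h1.ne' (congrArg π.2 h), h1⟩

end Cut

end PermPattern

/-! ### The two growth rates agree -/

open PermPattern
theorem proposition3p6 (X : Set FinPerm) (hX : X ⊆ Av {decreasing 3})
    (α β : FinPerm) (hα : α ∈ Av {decreasing 3}) (hβ : β ∈ Av {decreasing 3})
    (hrigid : IsRigid 2 α)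
    (hαβ : directSum α β ∈ Av {decreasing 3} ∩ Av X)
    (hinf : (Av {decreasing 3} ∩ Av X ∩ Av {directSum α β}).Infinite) :
    growthRate (Av {decreasing 3} ∩ Av X ∩ Av {directSum α β}) =
      growthRate (Av {decreasing 3} ∩ Av X ∩ Av {directSum α (directSum single β)}) := by
  have hclass : IsClass (Av {decreasing 3} ∩ Av X ∩ Av {directSum α β}) :=
    ((isClass_av _).inter (isClass_av _)).inter (isClass_av _)
  refine le_antisymm (growthRate_mono ?_) (growthRate_le_of_hasCut hclass hinf ?_)
  · rintro π ⟨hπ, hav⟩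
    refine ⟨hπ, ?_⟩
    rintro σ rfl hinv
    obtain ⟨f, g, hfg⟩ := hinv.exists_below
    exact hav _ rfl ⟨f.directSum ((embeddingRight single β).trans g) fun i j => hfg i _⟩
  · rintro π ⟨hπ, hav⟩
    have h321 := no321_of_mem_av hπ.1
    refine ⟨h321, ?_⟩
    by_cases hinv : Involves π (directSum α β)
    · have hC : ∀ ρ, Embedding ρ π → ¬ Involves ρ (directSum α β) →
          ρ ∈ Av {decreasing 3} ∩ Av X ∩ Av {directSum α β} := by
        refine fun ρ e hρ => ⟨((isClass_av _).inter (isClass_av _)) ρ π e hπ, ?_⟩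
        rintro σ rfl
        exact hρ
      have hav' : ¬ Involves π (directSum α (directSum single β)) := hav _ rfl
      by_cases hβ0 : β.1 = 0
      · by_cases hπ0 : π.1 = 0
        · have : IsEmpty (Fin π.1) := by rw [hπ0]; infer_instance
          obtain ⟨σ, hσ⟩ := hinf.nonempty
          exact Or.inl (hclass π σ ⟨isEmptyElim, isEmptyElim, isEmptyElim⟩ hσ)
        · exact Or.inr (hasCut_of_isEmpty hβ0 hav' hC ⟨0, Nat.pos_of_ne_zero hπ0⟩)
      · exact Or.inr (hasCut_of_involves hrigid h321 ⟨0, Nat.pos_of_ne_zero hβ0⟩ hav' hinv hC)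
    · refine Or.inl ⟨hπ, ?_⟩
      rintro σ rfl
      exact hinv
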